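/- A skew lattice is an algebra $(S;\vee,\wedge)$ in which $\vee,\wedge$ are associative and idempotent and $x\wedge(x\vee y)=x=(y\vee x)\wedge x$, $x\vee(x\wedge y)=x=(y\wedge x)\vee x$ hold. Write $x\succeq y$ if $x\vee y\vee x=x$, $x\succ y$ if $x\succeq y$ but not $y\succeq x$, $x\ge y$ if $x\vee y=x=y\vee x$, and $x>y$ if $x\ge y$ and $x\ne y$. The $\mathcal D$-classes are the classes of the equivalence $x\succeq y\succeq x$, and $A>B$ for $\mathcal D$-classes means $x\succ y$ for all $x\in A$, $y\in B$. For $\mathcal D$-classes $A>B$, an $A$-coset in $B$ is a set $A\wedge b\wedge A=\{x\wedge b\wedge x' : x,x'\in A\}$ with $b\in B$, and a $B$-coset in $A$ is a set $B\vee a\vee B=\{y\vee a\vee y' : y,y'\in B\}$ with $a\in A$. A coset bijection from $A$ to $B$ is the partial bijection with graph $\{(x,y)\in X\times Y : x>y\}$, for a $B$-coset $X$ in $A$ and an $A$-coset $Y$ in $B$. $S$ is categorical if, for all $\mathcal D$-classes $A>B>C$ of $S$ and all coset bijections $\varphi$ from $A$ to $B$ and $\psi$ from $B$ to $C$, the composite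 $\psi\circ\varphi$, if nonempty, is a coset bijection from $A$ to $C$. $S$ is left-handed if $x\wedge y\wedge x=x\wedge y$ and $x\vee y\vee x=y\vee x$ for all $x,y$, and right-handed if $x\wedge y\wedge x=y\wedge x$ and $x\vee y\vee x=x\vee y$ for all $x,y$. $S$ contains a copy of $T$ if some subalgebra of $S$ is isomorphic to $T$. For $1\le n\le\omega$ let $\mathbf X_n$ be the left-handed skew lattice with three $\mathcal D$-classes $A>B_n>C$, where $A=\{a_1,a_2\}$, $C=\{c_1,c_2\}$ and $B_n=\{b_i\}$, with $i$ ranging over the integers modulo $2n$ if $n<\omega$ and over all integers if $n=\omega$, and with the following operations. Within each class, $x\wedge y=x$ and $x\vee y=y$. If $u$ lies in a higher class than $v$, then $v\wedge u=v$ and $v\vee u=u$. Finally, $a_i\wedge c_j=c_i$ and $a_i\vee c_j=a_j$; $a_i\wedge b_j$ is the element of $\{b_{2k-1},b_{2k}\}\ni b_j$ whose index has the parity of $i$, and $a_i\vee b_j$ is the $a$ whose index has the parity of $j$; $b_j\wedge c_i$ is the $c$ whose index has the parity of $j$, and $b_j\vee c_i$ is the element of $\{b_{2k},b_{2k+1}\}\ni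 b_j$ whose index has the parity of $i$. Let $\mathbf Y_n$ be its right-handed dual, on the same set with $x\wedge_{\mathbf Y}y=y\wedge_{\mathbf X}x$ and $x\vee_{\mathbf Y}y=y\vee_{\mathbf X}x$. Theorem. (1) A left-handed skew lattice is categorical if and only if it contains no copy of $\mathbf X_n$ for any $2\le n\le\omega$. (2) A right-handed skew lattice is categorical if and only if it contains no copy of $\mathbf Y_n$ for any $2\le n\le\omega$. (3) A skew lattice is categorical if and only if it contains no copy of $\mathbf X_n$ and no copy of $\mathbf Y_n$ for any $2\le n\le\omega$. (4) No algebra in the family $\mathbf X_n,\mathbf Y_n$ ($2\le n\le\omega$) embeds in another one: for $2\le m,n\le\omega$, if $m\ne n$ then $\mathbf X_m$ does not embed in $\mathbf X_n$ and $\mathbf Y_m$ does not embed in $\mathbf Y_n$; and for all such $m,n$ (including $m=n$), $\mathbf X_m$ does not embed in $\mathbf Y_n$ and $\mathbf Y_m$ does not embed in $\mathbf X_n$. -/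

import Mathlib

universe u v

/-- A skew lattice: `⊔` and `⊓` are associative and idempotent and satisfy the four
absorption identities. Here `⊔`, `⊓` are bare binary operations (not suprema and infima). -/
class SkewLattice (S : Type u) extends Max S, Min S where
  sup_assoc : ∀ x y z : S, (x ⊔ y) ⊔ z = x ⊔ (y ⊔ z)
  inf_assoc : ∀ x y z : S, (x ⊓ y) ⊓ z = x ⊓ (y ⊓ z)
  sup_idem : ∀ x : S, x ⊔ x = x
  inf_idem : ∀ x : S, x ⊓ x = x
  inf_sup_absorb_left : ∀ x y : S, x ⊓ (x ⊔ y) = x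
  inf_sup_absorb_right : ∀ x y : S, (y ⊔ x) ⊓ x = x
  sup_inf_absorb_left : ∀ x y : S, x ⊔ (x ⊓ y) = x
  sup_inf_absorb_right : ∀ x y : S, (y ⊓ x) ⊔ x = x

namespace SkewLattice

section Basic

variable {S : Type u} [SkewLattice S]

/-- The natural preorder `x ≽ y`. -/
def PreGE (x y : S) : Prop := x ⊔ y ⊔ x = x

/-- The strict part `x ≻ y` of the natural preorder. -/
def PreGT (x y : S) : Prop := PreGE x y ∧ ¬ PreGE y x

/-- The natural partial order `x ≥ y`. -/
def NatGE (x y : S) : Prop := x ⊔ y = x ∧ y ⊔ x = x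

/-- The strict natural partial order `x > y`. -/
def NatGT (x y : S) : Prop := NatGE x y ∧ x ≠ y

/-- Green's relation `D`. -/
def GreenD (x y : S) : Prop := PreGE x y ∧ PreGE y x

/-- `A` is a `D`-class. -/
def IsDClass (A : Set S) : Prop := ∃ x : S, A = {y | GreenD x y}

/-- The order `A > B` between `D`-classes. -/
def ClassGT (A B : Set S) : Prop := ∀ x ∈ A, ∀ y ∈ B, PreGT x y

/-- For `b ∈ B`, the `A`-coset `A ∧ b ∧ A` in the lower class `B`. -/
def lowerCoset (A : Set S) (b : S) : Set S := {y | ∃ x ∈ A, ∃ x' ∈ A, y = x ⊓ b ⊓ x'}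

/-- For `a ∈ A`, the `B`-coset `B ∨ a ∨ B` in the upper class `A`. -/
def upperCoset (B : Set S) (a : S) : Set S := {x | ∃ y ∈ B, ∃ y' ∈ B, x = y ⊔ a ⊔ y'}

/-- For `D`-classes `A > B`, the relation `φ` is (the graph of) a coset bijection from `A` to `B`:
there are a `B`-coset `X` in `A` and an `A`-coset `Y` in `B` such that `φ` is
the restriction of the natural partial order `>` to `X × Y`. -/
def IsCosetBijection (A B : Set S) (φ : S → S → Prop) : Prop :=
  ∃ a ∈ A, ∃ b ∈ B, ∀ x y, φ x y ↔ x ∈ upperCoset B a ∧ y ∈ lowerCoset A b ∧ NatGT x y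

variable (S) in
/-- `S` is categorical: for all `D`-classes `A > B > C`, every nonempty composite of
a coset bijection from `A` to `B` with one from `B` to `C` is a coset bijection from `A` to `C`. -/
def IsCategorical : Prop :=
  ∀ A B C : Set S, IsDClass A → IsDClass B → IsDClass C → ClassGT A B → ClassGT B C →
    ∀ φ ψ : S → S → Prop, IsCosetBijection A B φ → IsCosetBijection B C ψ →
      (∃ x z, Relation.Comp φ ψ x z) → IsCosetBijection A C (Relation.Comp φ ψ)

variable (S) in
/-- Left-handed skew lattices. -/
def IsLeftHanded : Prop := ∀ x y : S, x ⊓ y ⊓ x = x ⊓ y ∧ x ⊔ y ⊔ x = y ⊔ x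

variable (S) in
/-- Right-handed skew lattices. -/
def IsRightHanded : Prop := ∀ x y : S, x ⊓ y ⊓ x = y ⊓ x ∧ x ⊔ y ⊔ x = x ⊔ y

end Basic

/-- `T` embeds in `S`, that is, `S` contains a copy of `T` (a subalgebra isomorphic to `T`):
there is an injective map from `T` to `S` that preserves both operations. -/
def Embeds (T : Type u) (S : Type v) [SkewLattice T] [SkewLattice S] : Prop :=
  ∃ f : T → S, Function.Injective f ∧ (∀ x y, f (x ⊔ y) = f x ⊔ f y) ∧
    ∀ x y, f (x ⊓ y) = f x ⊓ f y

/-- The underlying set `{a₁, a₂} ∪ Bₙ ∪ {c₁, c₂}` of `Xₙ`, for `1 ≤ n ≤ ω` (with `ω = ⊤`).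
The `Bool` argument is the parity of the index, `true` for odd: `a true = a₁`, `a false = a₂`,
`c true = c₁`, `c false = c₂`, `b k true = b_{2k-1}`, `b k false = b_{2k}`.
The index `k` is an integer modulo `n` if `n` is finite and an arbitrary integer if `n = ω`
(since `(⊤ : ℕ∞).toNat = 0` and `ZMod 0 = ℤ`), so that the indices of the `b`s
are integers modulo `2n`, respectively integers. The value `n = 0` is not used. -/
inductive X (n : ℕ∞) : Type
  | a (p : Bool) : X n
  | b (k : ZMod n.toNat) (p : Bool) : X n
  | c (p : Bool) : X n

namespace X

variable {n : ℕ∞}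

/-- The element of parity `p` in the `A`-coset `{b_{2k-1}, b_{2k}}` of the given element of `Bₙ`. -/
def aMate (k : ZMod n.toNat) (_q p : Bool) : X n := b k p

/-- The element of parity `p` in the `C`-coset of the element of `Bₙ` with parity `q`;
the `C`-cosets are the sets `{b_{2k}, b_{2k+1}}`. -/
def cMate (k : ZMod n.toNat) : Bool → Bool → X n
  | true, true => b k true
  | false, false => b k false
  | false, true => b (k + 1) true
  | true, false => b (k - 1) false

/-- The left-handed meet of `Xₙ`: on each class it is the left projection, and for `u` in a higher
class than `v`, `v ∧ u = v` while `u ∧ v` is the element below `u` in the coset of `v`. -/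
def inf : X n → X n → X n
  | a p, a _ => a p
  | a p, b k q => aMate k q p
  | a p, c _ => c p
  | b k p, a _ => b k p
  | b k p, b _ _ => b k p
  | b _ p, c _ => c p
  | c p, _ => c p

/-- The left-handed join of `Xₙ`: on each class it is the right projection, and for `u` in a higher
class than `v`, `v ∨ u = u` while `u ∨ v` is the element above `v` in the coset of `u`. -/
def sup : X n → X n → X n
  | _, a p => a p
  | a _, b _ q => a q
  | a _, c q => a q
  | b _ _, b k q => b k q
  | b k p, c q => cMate k p q
  | c _, b k p => b k p
  | c _, c p => c p

/-- The left-handed skew chain `Xₙ`. -/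
instance : SkewLattice (X n) where
  max := sup
  min := inf
  sup_assoc := by
    rintro (_ | ⟨k, _ | _⟩ | (_ | _)) (_ | ⟨l, _ | _⟩ | (_ | _)) (_ | ⟨m, _ | _⟩ | (_ | _)) <;>
      simp [sup, cMate]
  inf_assoc := by
    rintro (_ | ⟨_, _⟩ | _) (_ | ⟨_, _⟩ | _) (_ | ⟨_, _⟩ | _) <;> rfl
  sup_idem := by rintro (_ | ⟨_, _⟩ | _) <;> rfl
  inf_idem := by rintro (_ | ⟨_, _⟩ | _) <;> rfl
  inf_sup_absorb_left := by
    rintro (_ | ⟨k, _ | _⟩ | (_ | _)) (_ | ⟨l, _ | _⟩ | (_ | _)) <;> rfl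
  inf_sup_absorb_right := by
    rintro (_ | ⟨k, _ | _⟩ | (_ | _)) (_ | ⟨l, _ | _⟩ | (_ | _)) <;> rfl
  sup_inf_absorb_left := by
    rintro (_ | ⟨k, _ | _⟩ | (_ | _)) (_ | ⟨l, _ | _⟩ | (_ | _)) <;> rfl
  sup_inf_absorb_right := by
    rintro (_ | ⟨k, _ | _⟩ | (_ | _)) (_ | ⟨l, _ | _⟩ | (_ | _)) <;> rfl

end X

/-- The (left-right) dual of a skew lattice: both operations with their arguments exchanged. -/
@[ext]
structure LRDual (S : Type u) : Type u where
  /-- The element of `S` underlying an element of the dual. -/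
  un : S

/-- The skew lattice structure on the left-right dual. -/
instance {S : Type u} [SkewLattice S] : SkewLattice (LRDual S) where
  max x y := ⟨y.un ⊔ x.un⟩
  min x y := ⟨y.un ⊓ x.un⟩
  sup_assoc x y z := congrArg LRDual.mk (sup_assoc z.un y.un x.un).symm
  inf_assoc x y z := congrArg LRDual.mk (inf_assoc z.un y.un x.un).symm
  sup_idem x := congrArg LRDual.mk (sup_idem x.un)
  inf_idem x := congrArg LRDual.mk (inf_idem x.un)
  inf_sup_absorb_left x y := congrArg LRDual.mk (inf_sup_absorb_right x.un y.un)
  inf_sup_absorb_right x y := congrArg LRDual.mk (inf_sup_absorb_left x.un y.un)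
  sup_inf_absorb_left x y := congrArg LRDual.mk (sup_inf_absorb_right x.un y.un)
  sup_inf_absorb_right x y := congrArg LRDual.mk (sup_inf_absorb_left x.un y.un)

/-- The right-handed dual `Yₙ` of `Xₙ`. -/
abbrev Y (n : ℕ∞) : Type := LRDual (X n)

end SkewLattice

/-! A coset bijection is determined by any of its pairs, so categoricity becomes the elementwise law
`IsConfluent`: if a ≥ b ≥ c, and x, z correspond under the coset bijection through (a, c), then x ∧
b ∧ x (moving b within a coset of the upper class) equals z ∨ b ∨ z (moving b within a coset of the
lower class). Since each D-class is a rectangular band, this law follows from a left half,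
`IsLeftConfluent`, together with the left half of the dual algebra.

If the left half fails, the elements involved form a `Ladder`. Moving b alternately by a join with
the lower class and a meet with the upper class walks along overlapping cosets, and two such moves
are a permutation, `Ladder.step`. The orbit of b, filled in with the intermediate elements, has the
operations of `X n`, where n is the size of the orbit; n = 1 is precisely the confluent case.
Conversely, in `X n` with n ≥ 2 the two ways of moving b differ.

For the independence of the family, the shift of the even-indexed b's by two is given by a term, so
an embedding carries it to a shift by two in either direction, and the cycle lengths agree.
Handedness separates the X's from the Y's. -/

namespace SkewLattice

/-! ### Band calculus: the natural preorder, D-classes and rectangular cancellation. -/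

section Basic

variable {S : Type u} [SkewLattice S]

instance : Std.Associative (α := S) (· ⊔ ·) := ⟨sup_assoc⟩
instance : Std.Associative (α := S) (· ⊓ ·) := ⟨inf_assoc⟩
instance : Std.IdempotentOp (α := S) (· ⊔ ·) := ⟨sup_idem⟩
instance : Std.IdempotentOp (α := S) (· ⊓ ·) := ⟨inf_idem⟩

theorem inf_eq_left_iff {x y : S} : x ⊓ y = x ↔ x ⊔ y = y := by
  constructor <;> intro h
  · simpa [h] using sup_inf_absorb_right y x
  · simpa [h] using inf_sup_absorb_left x y

theorem inf_eq_right_iff {x y : S} : x ⊓ y = y ↔ x ⊔ y = x := by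
  constructor <;> intro h
  · simpa [h] using sup_inf_absorb_left x y
  · simpa [h] using inf_sup_absorb_right y x

theorem natGE_iff {x y : S} : NatGE x y ↔ x ⊓ y = y ∧ y ⊓ x = y := by
  rw [NatGE, inf_eq_right_iff, inf_eq_left_iff]

/-- An element of the ideal generated by x absorbs x: multiply (zx)(zx) = zx on the right by q and
use zxq = z. -/
theorem inf_inf_of_eq {p x q z : S} (h : z = p ⊓ x ⊓ q) : z ⊓ x ⊓ z = z := by
  have h1 := inf_idem (x ⊓ q)
  have h2 := inf_idem (z ⊓ x)
  grind

theorem sup_sup_of_eq {p x q z : S} (h : z = p ⊔ x ⊔ q) : z ⊔ x ⊔ z = z := by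
  have h1 := sup_idem (x ⊔ q)
  have h2 := sup_idem (z ⊔ x)
  grind

theorem preGE_iff {x y : S} : PreGE x y ↔ y ⊓ x ⊓ y = y := by
  rw [PreGE]
  constructor <;> intro h
  · have h1 := inf_sup_absorb_right y x
    have h2 : (x ⊔ y) ⊓ x = x ⊔ y := inf_eq_left_iff.2 h
    have h3 := sup_inf_absorb_right (x ⊓ y) (x ⊔ y)
    rw [inf_assoc, inf_eq_left_iff]
    grind
  · have h1 := sup_inf_absorb_right x y
    have h2 : (y ⊓ x) ⊔ y = y ⊓ x := inf_eq_right_iff.1 h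
    have h3 := inf_sup_absorb_right (y ⊔ x) (y ⊓ x)
    rw [sup_assoc, ← inf_eq_right_iff]
    grind

theorem PreGE.refl (x : S) : PreGE x x := by
  simp [PreGE, sup_idem]

theorem PreGE.trans {x y z : S} (h : PreGE x y) (h' : PreGE y z) : PreGE x z := by
  rw [preGE_iff] at *
  apply inf_inf_of_eq (p := z ⊓ y) (q := y ⊓ z)
  grind

theorem preGE_inf_left (x y : S) : PreGE x (x ⊓ y) := by
  rw [preGE_iff]; exact inf_inf_of_eq (p := x) (q := y) (by grind)

theorem preGE_inf_right (x y : S) : PreGE y (x ⊓ y) := by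
  rw [preGE_iff]; exact inf_inf_of_eq (p := x) (q := y) (by grind)

theorem preGE_sup_left (x y : S) : PreGE (x ⊔ y) x :=
  sup_sup_of_eq (p := x) (q := y) (by grind)

theorem preGE_sup_right (x y : S) : PreGE (x ⊔ y) y :=
  sup_sup_of_eq (p := x) (q := y) (by grind)

/-- Since z = z(yzx)z, squaring the idempotent yzx exhibits xy as a factor of z. With its dual, this
keeps meets and joins of comparable elements inside the expected D-class. -/
theorem PreGE.inf {x y z : S} (h : PreGE x z) (h' : PreGE y z) : PreGE (x ⊓ y) z := by
  rw [preGE_iff] at *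
  have h1 := inf_idem (y ⊓ z ⊓ x)
  have h2 : z = z ⊓ (y ⊓ z ⊓ x) ⊓ z := by grind
  apply inf_inf_of_eq (p := z ⊓ y ⊓ z) (q := z ⊓ x ⊓ z)
  rw [← h1] at h2
  grind

theorem PreGE.sup {x y z : S} (h : PreGE z x) (h' : PreGE z y) : PreGE z (x ⊔ y) := by
  rw [PreGE] at *
  have h1 := sup_idem (y ⊔ z ⊔ x)
  have h2 : z = z ⊔ (y ⊔ z ⊔ x) ⊔ z := by grind
  apply sup_sup_of_eq (p := z ⊔ y ⊔ z) (q := z ⊔ x ⊔ z)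
  rw [← h1] at h2
  grind

theorem GreenD.refl (x : S) : GreenD x x := ⟨.refl x, .refl x⟩

theorem GreenD.symm {x y : S} (h : GreenD x y) : GreenD y x := ⟨h.2, h.1⟩

theorem GreenD.trans {x y z : S} (h : GreenD x y) (h' : GreenD y z) : GreenD x z :=
  ⟨h.1.trans h'.1, h'.2.trans h.2⟩

theorem PreGE.greenD_inf_left {x y : S} (h : PreGE x y) : GreenD y (x ⊓ y) :=
  ⟨preGE_inf_right x y, h.inf (.refl y)⟩

theorem PreGE.greenD_inf_right {x y : S} (h : PreGE x y) : GreenD y (y ⊓ x) :=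
  ⟨preGE_inf_left y x, (PreGE.refl y).inf h⟩

theorem PreGE.greenD_sup_left {x y : S} (h : PreGE x y) : GreenD x (x ⊔ y) :=
  ⟨(PreGE.refl x).sup h, preGE_sup_left x y⟩

theorem PreGE.greenD_sup_right {x y : S} (h : PreGE x y) : GreenD x (y ⊔ x) :=
  ⟨h.sup (.refl x), preGE_sup_right y x⟩

/-- On a `D`-class, which is a rectangular band, join and meet are opposite to each other. -/
theorem GreenD.inf_eq_sup {x y : S} (h : GreenD x y) : x ⊓ y = y ⊔ x := by
  have h1 := preGE_iff.1 h.1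
  have h2 : x ⊓ (y ⊔ x) = y ⊔ x := inf_eq_right_iff.2 (by have := h.1; rw [PreGE] at this; grind)
  have h3 : (y ⊔ x) ⊓ y = y ⊔ x := inf_eq_left_iff.2 h.2
  have h4 := inf_sup_absorb_right x y
  grind

theorem inf_inf_cancel {x y z : S} (h : GreenD x z) (h' : PreGE y x) : x ⊓ y ⊓ z = x ⊓ z := by
  have h1 := preGE_iff.1 h.1
  have h2 := preGE_iff.1 h.2
  have h3 := preGE_iff.1 (h.1.inf (h'.trans h.1))
  grind

theorem sup_sup_cancel {x y z : S} (h : GreenD x z) (h' : PreGE x y) : x ⊔ y ⊔ z = x ⊔ z := by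
  have h1 := h.1
  have h2 := h.2
  have h3 := h.2.sup (h.2.trans h')
  rw [PreGE] at h1 h2 h3
  grind

/-- Write b as (b ∨ x ∨ b) ∧ b. The first factor lies in the D-class of x, where the rectangular law
deletes u. -/
theorem inf_inf_absorb_left {x u b : S} (h : GreenD x u) (h' : PreGE x b) :
    x ⊓ u ⊓ b = x ⊓ b := by
  have h1 : (b ⊔ x ⊔ b) ⊓ b = b := inf_sup_absorb_right b (b ⊔ x)
  have h2 : GreenD x (b ⊔ x ⊔ b) := (h'.greenD_sup_right).trans
    ((h'.greenD_sup_right.2.trans h').greenD_sup_left)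
  have := congrArg (· ⊓ b) (inf_inf_cancel h2 h.2)
  grind

theorem inf_inf_absorb_right {x u b : S} (h : GreenD x u) (h' : PreGE x b) :
    b ⊓ u ⊓ x = b ⊓ x := by
  have h1 : b ⊓ (b ⊔ (x ⊔ b)) = b := inf_sup_absorb_left b (x ⊔ b)
  have h2 : GreenD x (b ⊔ (x ⊔ b)) := h'.greenD_sup_left.trans
    ((h'.greenD_sup_left.2.trans h').greenD_sup_right)
  have := congrArg (b ⊓ ·) (inf_inf_cancel h2.symm (h.2.trans h2.1))
  grind

theorem sup_sup_absorb_left {x u b : S} (h : GreenD x u) (h' : PreGE b x) :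
    x ⊔ u ⊔ b = x ⊔ b := by
  have h1 : (b ⊓ x ⊓ b) ⊔ b = b := sup_inf_absorb_right b (b ⊓ x)
  have h2 : GreenD x (b ⊓ x ⊓ b) := (h'.greenD_inf_left).trans
    ((h'.trans h'.greenD_inf_left.1).greenD_inf_right)
  have := congrArg (· ⊔ b) (sup_sup_cancel h2 h.1)
  grind

theorem sup_sup_absorb_right {x u b : S} (h : GreenD x u) (h' : PreGE b x) :
    b ⊔ u ⊔ x = b ⊔ x := by
  have h1 : b ⊔ (b ⊓ (x ⊓ b)) = b := sup_inf_absorb_left b (x ⊓ b)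
  have h2 : GreenD x (b ⊓ (x ⊓ b)) := h'.greenD_inf_right.trans
    ((h'.trans h'.greenD_inf_right.1).greenD_inf_left)
  have := congrArg (b ⊔ ·) (sup_sup_cancel h2.symm (h2.2.trans h.1))
  grind

theorem NatGE.preGE {x y : S} (h : NatGE x y) : PreGE x y := by
  rw [PreGE, h.1, sup_idem]

theorem NatGE.trans {x y z : S} (h : NatGE x y) (h' : NatGE y z) : NatGE x z :=
  ⟨by rw [← h.1, sup_assoc, h'.1], by rw [← h.2, ← sup_assoc, h'.2]⟩

theorem natGE_of_eq_inf {x y u : S} (h : y = x ⊓ u ⊓ x) : NatGE x y := by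
  rw [natGE_iff]; grind

theorem natGE_of_eq_sup {x y u : S} (h : x = y ⊔ u ⊔ y) : NatGE x y := by
  unfold NatGE; grind

end Basic
end SkewLattice
namespace SkewLattice

/-! ### Cosets, coset bijections and the elementwise form of categoricity. -/

section Categorical

variable {S : Type u} [SkewLattice S] {A B C : Set S}

theorem IsDClass.greenD (hA : IsDClass A) {x y : S} (hx : x ∈ A) (hy : y ∈ A) : GreenD x y := by
  obtain ⟨w, rfl⟩ := hA
  exact GreenD.trans (GreenD.symm hx) hy

theorem IsDClass.mem (hA : IsDClass A) {x y : S} (hx : x ∈ A) (h : GreenD x y) : y ∈ A := by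
  obtain ⟨w, rfl⟩ := hA
  exact GreenD.trans hx h

theorem ClassGT.preGE (h : ClassGT A B) {x y : S} (hx : x ∈ A) (hy : y ∈ B) : PreGE x y :=
  (h x hx y hy).1

theorem ClassGT.ne (h : ClassGT A B) {x y : S} (hx : x ∈ A) (hy : y ∈ B) : x ≠ y := by
  rintro rfl
  exact (h x hx x hy).2 (.refl x)

theorem ClassGT.trans (h : ClassGT A B) (h' : ClassGT B C) (hB : B.Nonempty) : ClassGT A C := by
  obtain ⟨y, hy⟩ := hB
  intro x hx z hz
  exact ⟨(h.preGE hx hy).trans (h'.preGE hy hz),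
    fun hzx => (h x hx y hy).2 ((h'.preGE hy hz).trans hzx)⟩

theorem lowerCoset_subset (hB : IsDClass B) (hAB : ClassGT A B) {b : S} (hb : b ∈ B) :
    lowerCoset A b ⊆ B := by
  rintro _ ⟨p, hp, q, hq, rfl⟩
  have h := (hAB.preGE hp hb).greenD_inf_left
  exact hB.mem hb (h.trans (((hAB.preGE hq hb).trans h.1).greenD_inf_right))

theorem upperCoset_subset (hA : IsDClass A) (hAB : ClassGT A B) {a : S} (ha : a ∈ A) :
    upperCoset B a ⊆ A := by
  rintro _ ⟨p, hp, q, hq, rfl⟩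
  have h := (hAB.preGE ha hp).greenD_sup_right
  exact hA.mem ha (h.trans ((h.2.trans (hAB.preGE ha hq)).greenD_sup_left))

theorem lowerCoset_eq (hA : IsDClass A) (hAB : ClassGT A B) {b b₀ : S}
    (hb₀ : b₀ ∈ B) (hb : b ∈ lowerCoset A b₀) : lowerCoset A b = lowerCoset A b₀ := by
  obtain ⟨u, hu, w, hw, rfl⟩ := hb
  have key : ∀ p ∈ A, ∀ q ∈ A, p ⊓ (u ⊓ b₀ ⊓ w) ⊓ q = p ⊓ b₀ ⊓ q := by
    intro p hp q hq
    have h1 := inf_inf_absorb_left (hA.greenD hp hu) (hAB.preGE hp hb₀)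
    have h2 := inf_inf_absorb_right (hA.greenD hq hw) (hAB.preGE hq hb₀)
    grind
  ext y
  constructor
  · rintro ⟨p, hp, q, hq, rfl⟩
    exact ⟨p, hp, q, hq, key p hp q hq⟩
  · rintro ⟨p, hp, q, hq, rfl⟩
    exact ⟨p, hp, q, hq, (key p hp q hq).symm⟩

theorem upperCoset_eq (hB : IsDClass B) (hAB : ClassGT A B) {a a₀ : S}
    (ha₀ : a₀ ∈ A) (ha : a ∈ upperCoset B a₀) : upperCoset B a = upperCoset B a₀ := by
  obtain ⟨u, hu, w, hw, rfl⟩ := ha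
  have key : ∀ p ∈ B, ∀ q ∈ B, p ⊔ (u ⊔ a₀ ⊔ w) ⊔ q = p ⊔ a₀ ⊔ q := by
    intro p hp q hq
    have h1 := sup_sup_absorb_left (hB.greenD hp hu) (hAB.preGE ha₀ hp)
    have h2 := sup_sup_absorb_right (hB.greenD hq hw) (hAB.preGE ha₀ hq)
    grind
  ext y
  constructor
  · rintro ⟨p, hp, q, hq, rfl⟩
    exact ⟨p, hp, q, hq, key p hp q hq⟩
  · rintro ⟨p, hp, q, hq, rfl⟩
    exact ⟨p, hp, q, hq, (key p hp q hq).symm⟩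

/-- A coset contains at most one element below x, with an explicit formula; this makes coset
bijections single-valued. -/
theorem eq_inf_of_mem_lowerCoset (hA : IsDClass A) (hAB : ClassGT A B) {b x y : S} (hb : b ∈ B)
    (hx : x ∈ A) (hxy : NatGE x y) (hy : y ∈ lowerCoset A b) : y = x ⊓ b ⊓ x := by
  obtain ⟨p, hp, q, hq, rfl⟩ := hy
  have h1 := inf_inf_absorb_left (hA.greenD hx hp) (hAB.preGE hx hb)
  have h2 := inf_inf_absorb_right (hA.greenD hx hq) (hAB.preGE hx hb)
  have h3 := natGE_iff.1 hxy
  calc p ⊓ b ⊓ q = x ⊓ (p ⊓ b ⊓ q) ⊓ x := by rw [h3.1, h3.2]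
    _ = (x ⊓ p ⊓ b) ⊓ (q ⊓ x) := by simp only [inf_assoc]
    _ = x ⊓ (b ⊓ q ⊓ x) := by rw [h1]; simp only [inf_assoc]
    _ = x ⊓ b ⊓ x := by rw [h2, inf_assoc]

theorem eq_sup_of_mem_upperCoset (hB : IsDClass B) (hAB : ClassGT A B) {a x y : S} (ha : a ∈ A)
    (hy : y ∈ B) (hxy : NatGE x y) (hx : x ∈ upperCoset B a) : x = y ⊔ a ⊔ y := by
  obtain ⟨p, hp, q, hq, rfl⟩ := hx
  have h1 := sup_sup_absorb_left (hB.greenD hy hp) (hAB.preGE ha hy)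
  have h2 := sup_sup_absorb_right (hB.greenD hy hq) (hAB.preGE ha hy)
  calc p ⊔ a ⊔ q = y ⊔ (p ⊔ a ⊔ q) ⊔ y := by rw [hxy.2, hxy.1]
    _ = (y ⊔ p ⊔ a) ⊔ (q ⊔ y) := by simp only [sup_assoc]
    _ = y ⊔ (a ⊔ q ⊔ y) := by rw [h1]; simp only [sup_assoc]
    _ = y ⊔ a ⊔ y := by rw [h2, sup_assoc]

/-- A coset bijection is determined by any of its pairs. -/
theorem IsCosetBijection.iff_of_rel (hA : IsDClass A) (hB : IsDClass B) (hAB : ClassGT A B)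
    {φ : S → S → Prop} (hφ : IsCosetBijection A B φ) {a b : S} (hab : φ a b) :
    a ∈ A ∧ b ∈ B ∧ NatGE a b ∧
      ∀ x y, φ x y ↔ x ∈ upperCoset B a ∧ y ∈ lowerCoset A b ∧ NatGT x y := by
  obtain ⟨a₀, ha₀, b₀, hb₀, h⟩ := hφ
  obtain ⟨h1, h2, h3⟩ := (h a b).1 hab
  rw [upperCoset_eq hB hAB ha₀ h1, lowerCoset_eq hA hAB hb₀ h2]
  exact ⟨upperCoset_subset hA hAB ha₀ h1, lowerCoset_subset hB hAB hb₀ h2, h3.1, h⟩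

theorem mem_lowerCoset_of_natGE {a b : S} (ha : a ∈ A) (h : NatGE a b) : b ∈ lowerCoset A b := by
  rw [natGE_iff] at h
  exact ⟨a, ha, a, ha, by rw [h.1, h.2]⟩

theorem mem_upperCoset_of_natGE {a b : S} (hb : b ∈ B) (h : NatGE a b) : a ∈ upperCoset B a :=
  ⟨b, hb, b, hb, by rw [h.2, h.1]⟩

variable (S) in
/-- Coset bijections compose, stated elementwise: going down from the `D`-class of `a` to that of
`c` directly or through that of `b` gives the same result. -/
def IsConfluent : Prop :=
  ∀ a b c x z : S, NatGE a b → NatGE b c → GreenD a x → GreenD c z →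
    x = z ⊔ a ⊔ z → z = x ⊓ c ⊓ x → x ⊓ b ⊓ x = z ⊔ b ⊔ z

theorem IsConfluent.isCategorical (hS : IsConfluent S) : IsCategorical S := by
  rintro A B C hA hB hC hAB hBC φ ψ hφ hψ ⟨a, c, b, hab, hbc⟩
  obtain ⟨ha, hb, hab, hφ⟩ := hφ.iff_of_rel hA hB hAB hab
  obtain ⟨-, hc, hbc, hψ⟩ := hψ.iff_of_rel hB hC hBC hbc
  have hAC := hAB.trans hBC ⟨b, hb⟩
  -- The composite contains (a, c), so it can only be the coset bijection through that pair.
  refine ⟨a, ha, c, hc, fun x z => ?_⟩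
  constructor
  · rintro ⟨y, hxy, hyz⟩
    obtain ⟨hx, hy, hxy, -⟩ := (hφ x y).1 hxy
    obtain ⟨hy', hz, hyz, -⟩ := (hψ y z).1 hyz
    have hxA := upperCoset_subset hA hAB ha hx
    have hyB := lowerCoset_subset hB hAB hb hy
    have hzC := lowerCoset_subset hC hBC hc hz
    have h1 := eq_inf_of_mem_lowerCoset hA hAB hb hxA hxy hy
    have h2 := eq_sup_of_mem_upperCoset hB hAB ha hyB hxy hx
    have h3 := eq_inf_of_mem_lowerCoset hB hBC hc hyB hyz hz
    have h4 := eq_sup_of_mem_upperCoset hC hBC hb hzC hyz hy'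
    refine ⟨⟨z, hzC, z, hzC, ?_⟩, ⟨x, hxA, x, hxA, ?_⟩, hxy.trans hyz, hAC.ne hxA hzC⟩
    · have h5 : b ⊔ z ⊔ b = b := (hBC.preGE hb hzC)
      have h6 := hab.1
      have h7 := hab.2
      have h8 : b ⊔ z ⊔ a = a := by grind only
      have h9 : a ⊔ z ⊔ b = a := by grind only
      calc x = z ⊔ b ⊔ z ⊔ a ⊔ (z ⊔ b ⊔ z) := by rw [h2, h4]
        _ = z ⊔ (b ⊔ z ⊔ a) ⊔ z ⊔ b ⊔ z := by simp only [sup_assoc]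
        _ = z ⊔ (a ⊔ z ⊔ b) ⊔ z := by rw [h8]; simp only [sup_assoc]
        _ = _ := by rw [h9]
    · have h5 : b ⊓ x ⊓ b = b := preGE_iff.1 (hAB.preGE hxA hb)
      have h6 := (natGE_iff.1 hbc).1
      have h7 := (natGE_iff.1 hbc).2
      have h8 : b ⊓ x ⊓ c = c := by grind only
      have h9 : c ⊓ x ⊓ b = c := by grind only
      calc z = x ⊓ b ⊓ x ⊓ c ⊓ (x ⊓ b ⊓ x) := by rw [h3, h1]
        _ = x ⊓ (b ⊓ x ⊓ c) ⊓ x ⊓ b ⊓ x := by simp only [inf_assoc]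
        _ = x ⊓ (c ⊓ x ⊓ b) ⊓ x := by rw [h8]; simp only [inf_assoc]
        _ = _ := by rw [h9]
  · rintro ⟨hx, hz, hxz, -⟩
    have hxA := upperCoset_subset hA hAC ha hx
    have hzC := lowerCoset_subset hC hAC hc hz
    have h1 := eq_inf_of_mem_lowerCoset hA hAC hc hxA hxz hz
    have h2 := eq_sup_of_mem_upperCoset hC hAC ha hzC hxz hx
    -- Confluence supplies the midpoint: one element is below x as x ∧ b ∧ x and above z as z ∨ b ∨
    -- z.
    have h3 := hS a b c x z hab hbc (hA.greenD ha hxA) (hC.greenD hc hzC) h2 h1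
    have hy : x ⊓ b ⊓ x ∈ lowerCoset A b := ⟨x, hxA, x, hxA, rfl⟩
    have hyB := lowerCoset_subset hB hAB hb hy
    refine ⟨x ⊓ b ⊓ x, (hφ _ _).2 ⟨?_, hy, natGE_of_eq_inf rfl, hAB.ne hxA hyB⟩,
      (hψ _ _).2 ⟨⟨z, hzC, z, hzC, h3⟩, ?_, natGE_of_eq_sup h3, hBC.ne hyB hzC⟩⟩
    · refine ⟨z ⊔ b, hB.mem hb (hBC.preGE hb hzC).greenD_sup_right,
        b ⊔ z, hB.mem hb (hBC.preGE hb hzC).greenD_sup_left, ?_⟩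
      have h6 := hab.1
      have h7 := hab.2
      grind
    · refine ⟨x ⊓ b, hB.mem hb (hAB.preGE hxA hb).greenD_inf_left,
        b ⊓ x, hB.mem hb (hAB.preGE hxA hb).greenD_inf_right, ?_⟩
      have h6 := (natGE_iff.1 hbc).1
      have h7 := (natGE_iff.1 hbc).2
      grind

variable (S) in
/-- The restriction of confluence to `L`-classes: `a` and `a'`, and `c` and `c'`, are `L`-related. -/
def IsLeftConfluent : Prop :=
  ∀ a b c a' c' : S, NatGE a b → NatGE b c → a ⊓ a' = a → a' ⊓ a = a' → c ⊓ c' = c → c' ⊓ c = c' →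
    a ⊔ c' = a' → a' ⊓ c = c' → a' ⊓ b = b ⊔ c'

/-- Replacing x by x ∧ a and z by z ∧ c turns D-related pairs into L-related ones without changing x
∧ b or b ∨ z. -/
theorem IsLeftConfluent.inf_eq_sup (hS : IsLeftConfluent S) {a b c x z : S} (hab : NatGE a b)
    (hbc : NatGE b c) (hax : GreenD a x) (hcz : GreenD c z) (hx : x = z ⊔ a ⊔ z)
    (hz : z = x ⊓ c ⊓ x) : x ⊓ b = b ⊔ z := by
  have e1 := hax.symm.inf_eq_sup
  have e2 := hcz.symm.inf_eq_sup
  have hac := natGE_iff.1 (hab.trans hbc)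
  have hab' := natGE_iff.1 hab
  have hax' : a ⊓ x ⊓ a = a := preGE_iff.1 hax.2
  have hcz' : c ⊓ z ⊓ c = c := preGE_iff.1 hcz.2
  have i1 := inf_idem (x ⊓ c)
  have i2 := sup_idem (a ⊔ z)
  have h1 : z ⊓ c = x ⊓ c := by grind
  have h2 : a ⊔ x = a ⊔ z := by grind
  have h := hS a b c (x ⊓ a) (z ⊓ c) hab hbc (by grind) (by grind) (by grind) (by grind)
    (by rw [e1, e2, h2, ← sup_assoc, (hab.trans hbc).1])
    (by rw [h1, inf_assoc, hac.1])
  rw [inf_assoc, hab'.1, e2, ← sup_assoc, hbc.1] at h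
  exact h

end Categorical

/-! ### Confluence from its left and right halves. -/

section LRDual

variable {S : Type u} [SkewLattice S]

theorem LRDual.natGE_iff {x y : S} : NatGE (⟨x⟩ : LRDual S) ⟨y⟩ ↔ NatGE x y := by
  simp only [NatGE, max, LRDual.mk.injEq]
  exact and_comm

theorem LRDual.preGE_iff {x y : S} : PreGE (⟨x⟩ : LRDual S) ⟨y⟩ ↔ PreGE x y := by
  simp only [PreGE, max, LRDual.mk.injEq]
  exact (sup_assoc x y x) ▸ Iff.rfl

theorem IsLeftConfluent.isConfluent (hS : IsLeftConfluent S) (hS' : IsLeftConfluent (LRDual S)) :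
    IsConfluent S := by
  intro a b c x z hab hbc hax hcz hx hz
  have h1 := hS.inf_eq_sup hab hbc hax hcz hx hz
  have h2 := hS'.inf_eq_sup (a := ⟨a⟩) (b := ⟨b⟩) (c := ⟨c⟩) (x := ⟨x⟩) (z := ⟨z⟩)
    (LRDual.natGE_iff.2 hab) (LRDual.natGE_iff.2 hbc)
    (by simpa [GreenD, LRDual.preGE_iff] using hax)
    (by simpa [GreenD, LRDual.preGE_iff] using hcz)
    (congrArg LRDual.mk (hx.trans (sup_assoc _ _ _)))
    (congrArg LRDual.mk (hz.trans (inf_assoc _ _ _)))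
  replace h2 : b ⊓ x = z ⊔ b := congrArg LRDual.un h2
  have hbz : PreGE b z := hbc.preGE.trans hcz.1
  have h3 : GreenD (b ⊔ z) (z ⊔ b) := hbz.greenD_sup_left.symm.trans hbz.greenD_sup_right
  have h4 := h3.inf_eq_sup
  have i := inf_idem b
  have i := sup_idem b
  -- The two one-sided identities are glued by a meet, which within a D-class is the join in reverse
  -- order.
  calc x ⊓ b ⊓ x = (x ⊓ b) ⊓ (b ⊓ x) := by grind
    _ = (z ⊔ b) ⊔ (b ⊔ z) := by rw [h1, h2, h4]
    _ = z ⊔ b ⊔ z := by grind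

end LRDual
end SkewLattice
namespace SkewLattice

/-! ### Transport along left-right duality. -/

section LRDual

variable {S : Type u} [SkewLattice S]

theorem LRDual.natGT_iff {x y : S} : NatGT (⟨x⟩ : LRDual S) ⟨y⟩ ↔ NatGT x y := by
  simp only [NatGT, LRDual.natGE_iff, ne_eq, LRDual.mk.injEq]

theorem LRDual.isDClass_preimage {A : Set (LRDual S)} (hA : IsDClass A) :
    IsDClass (LRDual.mk ⁻¹' A) := by
  obtain ⟨⟨w⟩, rfl⟩ := hA
  exact ⟨w, by ext y; simp [GreenD, LRDual.preGE_iff]⟩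

theorem LRDual.classGT_preimage {A B : Set (LRDual S)} (h : ClassGT A B) :
    ClassGT (LRDual.mk ⁻¹' A) (LRDual.mk ⁻¹' B) := by
  intro x hx y hy
  simpa [PreGT, LRDual.preGE_iff] using h _ hx _ hy

theorem LRDual.lowerCoset_preimage (A : Set (LRDual S)) (b : S) :
    lowerCoset (LRDual.mk ⁻¹' A) b = LRDual.mk ⁻¹' (lowerCoset A ⟨b⟩) := by
  ext y
  constructor
  · rintro ⟨p, hp, q, hq, rfl⟩
    exact ⟨⟨q⟩, hq, ⟨p⟩, hp, congrArg LRDual.mk (inf_assoc _ _ _)⟩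
  · rintro ⟨⟨p⟩, hp, ⟨q⟩, hq, h⟩
    exact ⟨q, hq, p, hp, (congrArg LRDual.un h).trans (inf_assoc _ _ _).symm⟩

theorem LRDual.upperCoset_preimage (B : Set (LRDual S)) (a : S) :
    upperCoset (LRDual.mk ⁻¹' B) a = LRDual.mk ⁻¹' (upperCoset B ⟨a⟩) := by
  ext y
  constructor
  · rintro ⟨p, hp, q, hq, rfl⟩
    exact ⟨⟨q⟩, hq, ⟨p⟩, hp, congrArg LRDual.mk (sup_assoc _ _ _)⟩
  · rintro ⟨⟨p⟩, hp, ⟨q⟩, hq, h⟩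
    exact ⟨q, hq, p, hp, (congrArg LRDual.un h).trans (sup_assoc _ _ _).symm⟩

theorem LRDual.isCosetBijection_preimage {A B : Set (LRDual S)}
    {φ : LRDual S → LRDual S → Prop} :
    IsCosetBijection (LRDual.mk ⁻¹' A) (LRDual.mk ⁻¹' B) (fun x y => φ ⟨x⟩ ⟨y⟩) ↔
      IsCosetBijection A B φ := by
  simp only [IsCosetBijection, LRDual.lowerCoset_preimage, LRDual.upperCoset_preimage]
  constructor
  · rintro ⟨a, ha, b, hb, h⟩
    refine ⟨⟨a⟩, ha, ⟨b⟩, hb, fun x y => (h x.un y.un).trans ?_⟩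
    exact Iff.rfl.and (Iff.rfl.and LRDual.natGT_iff.symm)
  · rintro ⟨⟨a⟩, ha, ⟨b⟩, hb, h⟩
    refine ⟨a, ha, b, hb, fun x y => (h ⟨x⟩ ⟨y⟩).trans ?_⟩
    exact Iff.rfl.and (Iff.rfl.and LRDual.natGT_iff)

theorem IsCategorical.lrDual (hS : IsCategorical S) : IsCategorical (LRDual S) := by
  rintro A B C hA hB hC hAB hBC φ ψ hφ hψ ⟨⟨x⟩, ⟨z⟩, ⟨y⟩, hxy, hyz⟩
  have h := hS _ _ _ (LRDual.isDClass_preimage hA) (LRDual.isDClass_preimage hB)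
    (LRDual.isDClass_preimage hC) (LRDual.classGT_preimage hAB) (LRDual.classGT_preimage hBC) _ _
    (LRDual.isCosetBijection_preimage.2 hφ) (LRDual.isCosetBijection_preimage.2 hψ)
    ⟨x, z, y, hxy, hyz⟩
  rw [← LRDual.isCosetBijection_preimage]
  convert h using 3 with p q
  exact ⟨fun ⟨⟨r⟩, h1, h2⟩ => ⟨r, h1, h2⟩, fun ⟨r, h1, h2⟩ => ⟨⟨r⟩, h1, h2⟩⟩

theorem IsLeftHanded.lrDual (hS : IsLeftHanded S) : IsRightHanded (LRDual S) := by
  rintro ⟨x⟩ ⟨y⟩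
  exact ⟨congrArg LRDual.mk ((inf_assoc x y x).symm.trans (hS x y).1),
    congrArg LRDual.mk ((sup_assoc x y x).symm.trans (hS x y).2)⟩

theorem IsRightHanded.lrDual (hS : IsRightHanded S) : IsLeftHanded (LRDual S) := by
  rintro ⟨x⟩ ⟨y⟩
  exact ⟨congrArg LRDual.mk ((inf_assoc x y x).symm.trans (hS x y).1),
    congrArg LRDual.mk ((sup_assoc x y x).symm.trans (hS x y).2)⟩

theorem Embeds.of_lrDual_left {T : Type v} [SkewLattice T] (h : Embeds (LRDual T) S) :
    Embeds T (LRDual S) := by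
  obtain ⟨f, hf, hsup, hinf⟩ := h
  exact ⟨fun x => ⟨f ⟨x⟩⟩, fun x y hxy => congrArg LRDual.un (hf (congrArg LRDual.un hxy)),
    fun x y => congrArg LRDual.mk (hsup ⟨y⟩ ⟨x⟩), fun x y => congrArg LRDual.mk (hinf ⟨y⟩ ⟨x⟩)⟩

theorem Embeds.lrDual_left {T : Type v} [SkewLattice T] (h : Embeds T (LRDual S)) :
    Embeds (LRDual T) S := by
  obtain ⟨f, hf, hsup, hinf⟩ := h
  exact ⟨fun x => (f x.un).un, fun x y hxy => LRDual.ext (hf (LRDual.ext hxy)),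
    fun x y => congrArg LRDual.un (hsup y.un x.un), fun x y => congrArg LRDual.un (hinf y.un x.un)⟩

theorem Embeds.of_lrDual_lrDual {T : Type v} [SkewLattice T] (h : Embeds (LRDual T) (LRDual S)) :
    Embeds T S := by
  obtain ⟨f, hf, hsup, hinf⟩ := h
  exact ⟨fun x => (f ⟨x⟩).un, fun x y hxy => congrArg LRDual.un (hf (LRDual.ext hxy)),
    fun x y => congrArg LRDual.un (hsup ⟨y⟩ ⟨x⟩), fun x y => congrArg LRDual.un (hinf ⟨y⟩ ⟨x⟩)⟩

end LRDual

/-! ### Confluence from categoricity. -/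

section Confluent

variable {S : Type u} [SkewLattice S]

theorem NatGE.eq_of_preGE {x y : S} (h : NatGE x y) (h' : PreGE y x) : x = y := by
  have := GreenD.inf_eq_sup ⟨h', h.preGE⟩
  rw [h.1, (natGE_iff.1 h).2] at this
  exact this.symm

theorem isDClass_setOf (x : S) : IsDClass {y | GreenD x y} := ⟨x, rfl⟩

theorem NatGE.classGT {x y : S} (h : NatGE x y) (hne : x ≠ y) :
    ClassGT {u | GreenD x u} {u | GreenD y u} := by
  intro u hu w hw
  exact ⟨(hu.2.trans h.preGE).trans hw.1,
    fun hwu => hne (h.eq_of_preGE ((hw.1.trans hwu).trans hu.2))⟩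

theorem IsCategorical.isConfluent (hS : IsCategorical S) : IsConfluent S := by
  intro a b c x z hab hbc hax hcz hx hz
  -- Coset bijections exist only between strictly comparable classes, so the degenerate cases are
  -- settled by hand.
  by_cases hab' : a = b
  · subst hab'
    rw [← hx]
    exact preGE_iff.1 hax.1
  by_cases hbc' : b = c
  · subst hbc'
    rw [← hz]
    exact hcz.2.symm
  have hA := isDClass_setOf a
  have hB := isDClass_setOf b
  have hC := isDClass_setOf c
  have hAB := hab.classGT hab'
  have hBC := hbc.classGT hbc'
  set A := {u | GreenD a u}
  set B := {u | GreenD b u}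
  set C := {u | GreenD c u}
  have ha : a ∈ A := .refl a
  have hb : b ∈ B := .refl b
  have hc : c ∈ C := .refl c
  have hAC := hAB.trans hBC ⟨b, hb⟩
  have h := hS A B C hA hB hC hAB hBC _ _ ⟨a, ha, b, hb, fun _ _ => Iff.rfl⟩
    ⟨b, hb, c, hc, fun _ _ => Iff.rfl⟩ ⟨a, c, b,
      ⟨mem_upperCoset_of_natGE hb hab, mem_lowerCoset_of_natGE ha hab, hab, hab'⟩,
      ⟨mem_upperCoset_of_natGE hc hbc, mem_lowerCoset_of_natGE hb hbc, hbc, hbc'⟩⟩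
  obtain ⟨-, -, -, h⟩ := h.iff_of_rel (a := a) (b := c) hA hC hAC ⟨b,
      ⟨mem_upperCoset_of_natGE hb hab, mem_lowerCoset_of_natGE ha hab, hab, hab'⟩,
      ⟨mem_upperCoset_of_natGE hc hbc, mem_lowerCoset_of_natGE hb hbc, hbc, hbc'⟩⟩
  -- The pair (x, z) must factor through some y, and uniqueness in cosets identifies y with both
  -- sides of the goal.
  obtain ⟨y, ⟨-, hy, hxy, -⟩, ⟨hy', -, hyz, -⟩⟩ := (h x z).2
    ⟨⟨z, hcz, z, hcz, hx⟩, ⟨x, hax, x, hax, hz⟩, natGE_of_eq_sup hx, hAC.ne hax hcz⟩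
  rw [← eq_inf_of_mem_lowerCoset hA hAB hb hax hxy hy,
    ← eq_sup_of_mem_upperCoset hC hBC hb hcz hyz hy']

end Confluent

/-! ### The algebras `X n`: failure of confluence and mutual non-embeddability. -/

namespace X

variable {n : ℕ∞}

theorem isLeftHanded (n : ℕ∞) : IsLeftHanded (X n) := by
  rintro (_ | ⟨k, _ | _⟩ | (_ | _)) (_ | ⟨l, _ | _⟩ | (_ | _)) <;>
    simp [max, min, sup, inf, cMate, aMate]

theorem zmod_one_ne_zero (hn : 2 ≤ n) : (1 : ZMod n.toNat) ≠ 0 := by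
  have : n.toNat ≠ 1 := by
    intro h
    cases n with
    | top => simp at h
    | coe n =>
      simp at h
      subst h
      norm_num at hn
  intro h
  have h' := (ZMod.natCast_eq_zero_iff 1 n.toNat).1 (by simpa using h)
  exact this (Nat.dvd_one.1 h')

theorem not_isConfluent_of_embeds {S : Type u} [SkewLattice S] (hn : 2 ≤ n)
    (h : Embeds (X n) S) : ¬ IsConfluent S := by
  obtain ⟨f, hf, hsup, hinf⟩ := h
  intro hS
  have h := hS (f (a false)) (f (b 0 false)) (f (c false)) (f (a true)) (f (c true))
    (by simp only [NatGE, ← hsup]; exact ⟨rfl, rfl⟩)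
    (by simp only [NatGE, ← hsup]; exact ⟨rfl, rfl⟩)
    (by simp only [GreenD, PreGE, ← hsup]; exact ⟨rfl, rfl⟩)
    (by simp only [GreenD, PreGE, ← hsup]; exact ⟨rfl, rfl⟩)
    (by simp only [← hsup]; rfl) (by simp only [← hinf]; rfl)
  simp only [← hsup, ← hinf] at h
  -- From b₀, the `A`-coset leads to b₋₁ and the `C`-coset to b₁; these agree only modulo 2.
  have h' : b 0 true = b (0 + 1) true := hf h
  simp only [b.injEq, zero_add, and_true] at h'
  exact zmod_one_ne_zero hn h'.symm

theorem not_embeds_of_isRightHanded {S : Type u} [SkewLattice S] (hS : IsRightHanded S) :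
    ¬ Embeds (X n) S := by
  rintro ⟨f, hf, hsup, hinf⟩
  have h := (hS (f (a false)) (f (a true))).1
  simp only [← hinf] at h
  have h' : (a false : X n) = a true := hf h
  simp at h'

/-- Strict three-element chains are rigid, which forces an embedding to respect the three levels and
to treat parity consistently. -/
theorem eq_of_natGT_natGT {x y z : X n} (h : NatGT x y) (h' : NatGT y z) :
    ∃ p k, x = a p ∧ y = b k p ∧ z = c p := by
  obtain ⟨⟨h1, h2⟩, h3⟩ := h
  obtain ⟨⟨h4, h5⟩, h6⟩ := h'
  rcases x with p | ⟨k, p⟩ | p <;> rcases y with q | ⟨l, q⟩ | q <;> rcases z with r | ⟨m, r⟩ | r <;>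
    simp_all [max, sup]
  cases p <;> cases r <;> simp_all [cMate]

theorem toNat_injOn {m n : ℕ∞} (hm : 2 ≤ m) (hn : 2 ≤ n) (h : m.toNat = n.toNat) : m = n := by
  cases m with
  | top =>
    cases n with
    | top => rfl
    | coe n =>
      simp at h
      subst h
      norm_num at hn
  | coe m =>
    cases n with
    | top =>
      simp at h
      subst h
      norm_num at hm
    | coe n => simpa using h

theorem eq_of_embeds {m n : ℕ∞} (hm : 2 ≤ m) (hn : 2 ≤ n) (h : Embeds (X m) (X n)) : m = n := by
  obtain ⟨f, hf, hsup, hinf⟩ := h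
  have key : ∀ p k, ∃ q l, f (a p) = a q ∧ f (b k p) = b l q ∧ f (c p) = c q := by
    intro p k
    apply eq_of_natGT_natGT
    · refine ⟨?_, hf.ne (by simp)⟩
      simp only [NatGE, ← hsup]
      exact ⟨rfl, rfl⟩
    · refine ⟨?_, hf.ne (by simp)⟩
      simp only [NatGE, ← hsup]
      cases p <;> exact ⟨rfl, rfl⟩
  choose q g ha hb hc using key
  have hq : ∀ p k, q p k = q p 0 := fun p k => by
    simpa using (ha p k).symm.trans (ha p 0)
  have hqne : q false 0 ≠ q true 0 := by
    intro h
    have := hf ((ha false 0).trans (h ▸ (ha true 0).symm))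
    simp at this
  have hginj : Function.Injective (g false) := by
    intro k l hkl
    have := hf ((hb false k).trans (by rw [hkl, hq, ← hq false l]; exact (hb false l).symm))
    simpa using this
  obtain ⟨ε, hε, hg⟩ : ∃ ε : ZMod n.toNat, (ε = 1 ∨ ε = -1) ∧
      ∀ k, g false (k + 1) = g false k + ε := by
    -- The successor b₂ₖ₊₂ = a₂ ∧ (b₂ₖ ∨ c₁) is a term, so `f` carries it to a shift: forward if `f`
    -- keeps parities, backward if it swaps them.
    have h1 : ∀ k, f (b (k + 1) false) = f (a false) ⊓ (f (b k false) ⊔ f (c true)) := by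
      intro k
      rw [← hsup, ← hinf]
      rfl
    simp only [hb, ha _ 0, hc _ 0, hq] at h1
    generalize q false 0 = r at *
    generalize q true 0 = s at *
    cases r <;> cases s
    · simp at hqne
    · refine ⟨1, .inl rfl, fun k => ?_⟩
      have : b (g false (k + 1)) false = b (g false k + 1) false := h1 k
      simpa using this
    · refine ⟨-1, .inr rfl, fun k => ?_⟩
      have : b (g false (k + 1)) true = b (g false k - 1) true := h1 k
      simpa [sub_eq_add_neg] using this
    · simp at hqne
  have hadd : ∀ N : ℕ, g false N = g false 0 + N * ε := by
    intro N
    induction N with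
    | zero => simp
    | succ N ih => rw [Nat.cast_succ, hg, ih]; push_cast; ring
  -- Returning to the start after N shifts means the same on both sides; for ω the modulus is 0 and
  -- only N = 0 returns.
  have hiff : ∀ N : ℕ, m.toNat ∣ N ↔ n.toNat ∣ N := by
    intro N
    rw [← ZMod.natCast_eq_zero_iff, ← ZMod.natCast_eq_zero_iff, ← hginj.eq_iff, hadd]
    rcases hε with rfl | rfl <;> simp
  exact toNat_injOn hm hn (Nat.dvd_antisymm ((hiff _).2 dvd_rfl) ((hiff _).1 dvd_rfl))

end X
end SkewLattice
namespace SkewLattice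

/-! ### Building a copy of `X n` from a failure of left confluence. -/

section Ladder

variable {S : Type u} [SkewLattice S]

/-- Two `L`-related elements `α p` and two `L`-related elements `γ p`, matched by a coset
bijection, together with an element `b` between `α false` and `γ false`. -/
structure Ladder (α γ : Bool → S) (b : S) : Prop where
  top_inf_top : ∀ p q, α p ⊓ α q = α p
  bot_inf_bot : ∀ p q, γ p ⊓ γ q = γ p
  top_inf_bot : ∀ p q, α p ⊓ γ q = γ p
  bot_inf_top : ∀ p q, γ p ⊓ α q = γ p
  top_sup_bot : ∀ p q, α p ⊔ γ q = α q
  top_ge : NatGE (α false) b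
  ge_bot : NatGE b (γ false)

/-- Green's relation `L` (of the meet). -/
def GreenL (x y : S) : Prop := x ⊓ y = x ∧ y ⊓ x = y

theorem greenL_iff {x y : S} : GreenL x y ↔ x ⊔ y = y ∧ y ⊔ x = x := by
  rw [GreenL, inf_eq_left_iff, inf_eq_left_iff]

theorem GreenL.trans {x y z : S} (hx : GreenL x y) (hy : GreenL y z) :
    GreenL x z :=
  ⟨by rw [← hx.1, inf_assoc, hy.1], by rw [← hy.2, inf_assoc, hx.2]⟩

theorem GreenL.symm {x y : S} (hx : GreenL x y) : GreenL y x := ⟨hx.2, hx.1⟩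

theorem GreenL.refl (x : S) : GreenL x x := ⟨inf_idem x, inf_idem x⟩

/-- The elements of the `L`-class of `b` that lie between `α p` and `γ p`. -/
def Rung (α γ : Bool → S) (b : S) (p : Bool) (y : S) : Prop :=
  GreenL y b ∧ α p ⊓ y = y ∧ y ⊔ γ p = y

namespace Ladder

variable {α γ : Bool → S} {b x y : S} {p q : Bool}

section
variable (h : Ladder α γ b)
include h

theorem inf_top (hy : GreenL y b) (p : Bool) : y ⊓ α p = y := by
  have h1 := (natGE_iff.1 h.top_ge).2
  calc y ⊓ α p = y ⊓ (b ⊓ (α false ⊓ α p)) := by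
        rw [← inf_assoc b, h1, ← inf_assoc, hy.1]
    _ = y := by rw [h.top_inf_top, h1, hy.1]

theorem bot_inf (hy : GreenL y b) (p : Bool) : γ p ⊓ y = γ p := by
  have h1 := (natGE_iff.1 h.ge_bot).2
  calc γ p ⊓ y = γ p ⊓ (γ false ⊓ b) ⊓ y := by rw [h1, h.bot_inf_bot]
    _ = γ p := by rw [inf_assoc, inf_assoc, hy.2, h1, h.bot_inf_bot]

theorem greenL_top_inf (hy : GreenL y b) (p : Bool) : GreenL (α p ⊓ y) b :=
  ⟨by rw [inf_assoc, hy.1], by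
    rw [← inf_assoc, h.inf_top ⟨inf_idem b, inf_idem b⟩, hy.2]⟩

theorem bot_sup (hy : GreenL y b) (p : Bool) : γ p ⊔ y = y :=
  inf_eq_left_iff.1 (h.bot_inf hy p)

theorem greenL_sup_bot (hy : GreenL y b) (p : Bool) : GreenL (y ⊔ γ p) b := by
  rw [greenL_iff] at *
  exact ⟨by rw [sup_assoc, h.bot_sup ⟨inf_idem b, inf_idem b⟩, hy.1], by
    rw [← sup_assoc, hy.2]⟩

theorem sup_top (hy : GreenL y b) (p : Bool) : y ⊔ α p = α p :=
  inf_eq_left_iff.1 (h.inf_top hy p)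

/-- Here α p = α false ∨ b ∨ γ p, and b ∨ γ p is L-related to y, hence absorbed in the join with y.
-/
theorem top_sup (hy : GreenL y b) (p q : Bool) : α p ⊔ y = α q ⊔ y := by
  have key : ∀ p, α p ⊔ y = α false ⊔ y := by
    intro p
    have h1 := greenL_iff.1 ((h.greenL_sup_bot (.refl b) p).trans hy.symm)
    calc α p ⊔ y = α false ⊔ (b ⊔ γ p ⊔ y) := by
          rw [← sup_assoc, ← sup_assoc, h.top_ge.1, h.top_sup_bot]
      _ = _ := by rw [h1.1]
  rw [key p, key q]

theorem inf_bot (hy : GreenL y b) (p q : Bool) : y ⊓ γ p = y ⊓ γ q := by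
  have key : ∀ p, y ⊓ γ p = y ⊓ γ false := by
    intro p
    have h1 := (h.greenL_top_inf (.refl b) p).trans hy.symm
    calc y ⊓ γ p = y ⊓ (α p ⊓ b) ⊓ γ false := by
          rw [inf_assoc, inf_assoc, (natGE_iff.1 h.ge_bot).1, h.top_inf_bot]
      _ = _ := by rw [h1.2]
  rw [key p, key q]

theorem rung_top_sup (hy : Rung α γ b p y) (q : Bool) : α q ⊔ y = α p := by
  rw [h.top_sup hy.1 q p, ← inf_eq_right_iff, hy.2.1]

theorem rung_inf_bot (hy : Rung α γ b p y) (q : Bool) : y ⊓ γ q = γ p := by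
  rw [h.inf_bot hy.1 q p, inf_eq_right_iff, hy.2.2]

theorem rung_top_inf (hy : Rung α γ b p y) (q : Bool) : Rung α γ b q (α q ⊓ y) := by
  refine ⟨h.greenL_top_inf hy.1 q, by rw [← inf_assoc, inf_idem], ?_⟩
  rw [← inf_eq_right_iff, inf_assoc, h.rung_inf_bot hy, h.top_inf_bot]

theorem rung_sup_bot (hy : Rung α γ b p y) (q : Bool) : Rung α γ b q (y ⊔ γ q) := by
  refine ⟨h.greenL_sup_bot hy.1 q, ?_, by rw [sup_assoc, sup_idem]⟩
  rw [inf_eq_right_iff, ← sup_assoc, h.rung_top_sup hy, h.top_sup_bot]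

theorem rung_base : Rung α γ b false b :=
  ⟨.refl b, (natGE_iff.1 h.top_ge).1, h.ge_bot.1⟩

theorem top_inf_top_inf (hy : Rung α γ b p y) (q : Bool) : α p ⊓ (α q ⊓ y) = y := by
  rw [← inf_assoc, h.top_inf_top, hy.2.1]

theorem bot_sup_bot (p q : Bool) : γ p ⊔ γ q = γ q := inf_eq_left_iff.1 (h.bot_inf_bot p q)

theorem sup_bot_sup_bot (hy : Rung α γ b p y) (q : Bool) : y ⊔ γ q ⊔ γ p = y := by
  rw [sup_assoc, h.bot_sup_bot, hy.2.2]

end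

/-- Two steps along the ladder: up one coset for the upper class, then one for the lower class. -/
def step (h : Ladder α γ b) : Equiv.Perm {y : S // Rung α γ b false y} where
  -- In the notation of `X n` this is b₂ₖ ↦ b₂ₖ₊₁ ↦ b₂ₖ₊₂; each half is undone by the move back to
  -- the old parity.
  toFun y := ⟨α false ⊓ (y.1 ⊔ γ true), h.rung_top_inf (h.rung_sup_bot y.2 true) false⟩
  invFun y := ⟨α true ⊓ y.1 ⊔ γ false, h.rung_sup_bot (h.rung_top_inf y.2 true) false⟩
  left_inv y := Subtype.ext (by
    change α true ⊓ (α false ⊓ (y.1 ⊔ γ true)) ⊔ γ false = y.1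
    rw [h.top_inf_top_inf (h.rung_sup_bot y.2 true), h.sup_bot_sup_bot y.2])
  right_inv y := Subtype.ext (by
    change α false ⊓ (α true ⊓ y.1 ⊔ γ false ⊔ γ true) = y.1
    rw [h.sup_bot_sup_bot (h.rung_top_inf y.2 true), h.top_inf_top_inf y.2])

/-- The orbit of b under `step` is indexed by the integers modulo its minimal period. A fixed b
would make the two moves agree, so the period is not 1. -/
theorem exists_enumeration (h : Ladder α γ b) (hb : α true ⊓ b ≠ b ⊔ γ true) :
    ∃ n : ℕ∞, 2 ≤ n ∧ ∃ e : ZMod n.toNat → {y : S // Rung α γ b false y},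
      Function.Injective e ∧ ∀ k, e (k + 1) = h.step (e k) := by
  set b₀ : {y : S // Rung α γ b false y} := ⟨b, h.rung_base⟩
  set N := Function.minimalPeriod (h.step • ·) b₀ with hN
  obtain ⟨n, hn, hnN⟩ : ∃ n : ℕ∞, 2 ≤ n ∧ n.toNat = N := by
    have hN1 : N ≠ 1 := by
      intro h1
      rw [hN, Function.minimalPeriod_eq_one_iff_isFixedPt] at h1
      have h2 : α false ⊓ (b ⊔ γ true) = b := congrArg Subtype.val h1
      apply hb
      calc α true ⊓ b = α true ⊓ (α false ⊓ (b ⊔ γ true)) := by rw [h2]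
        _ = _ := h.top_inf_top_inf (h.rung_sup_bot h.rung_base true) _
    -- Minimal period 0 encodes an infinite orbit, matching `(⊤ : ℕ∞).toNat = 0`.
    by_cases hN0 : N = 0
    · exact ⟨⊤, le_top, by simp [hN0]⟩
    · refine ⟨N, ?_, by simp⟩
      have : 2 ≤ N := by omega
      exact_mod_cast this
  have key : ∀ i j : ℤ, h.step ^ i • b₀ = h.step ^ j • b₀ ↔ (i : ZMod n.toNat) = j := by
    intro i j
    rw [ZMod.intCast_eq_intCast_iff_dvd_sub, hnN, hN,
      ← MulAction.zpow_smul_eq_iff_minimalPeriod_dvd, sub_eq_neg_add, zpow_add, mul_smul, zpow_neg,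
      inv_smul_eq_iff, eq_comm]
  refine ⟨n, hn, fun k => h.step ^ (k.cast : ℤ) • b₀, ?_, ?_⟩
  · intro k l hkl
    simpa using (key _ _).1 hkl
  · intro k
    change _ = h.step • h.step ^ (k.cast : ℤ) • b₀
    rw [← mul_smul, ← zpow_one_add, key]
    simp [add_comm]

theorem step_symm_apply (h : Ladder α γ b) {n : ℕ∞}
    {e : ZMod n.toNat → {y : S // Rung α γ b false y}} (he : ∀ k, e (k + 1) = h.step (e k))
    (k : ZMod n.toNat) : (e (k - 1)).1 = α true ⊓ (e k).1 ⊔ γ false := by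
  have h1 := he (k - 1)
  rw [sub_add_cancel] at h1
  have h2 : e (k - 1) = h.step.symm (e k) := by rw [h1, Equiv.symm_apply_apply]
  exact congrArg Subtype.val h2

/-- The orbit gives the even-indexed b's, and meeting with α true gives the odd ones. Any
coincidence between levels would collapse b onto α false or γ false. -/
theorem embeds_of_enumeration (h : Ladder α γ b) (hα : α true ≠ α false) (hγ : γ true ≠ γ false)
    (hαb : α false ≠ b) (hγb : b ≠ γ false) {n : ℕ∞}
    {e : ZMod n.toNat → {y : S // Rung α γ b false y}} (hinj : Function.Injective e)
    (he : ∀ k, e (k + 1) = h.step (e k)) : Embeds (X n) S := by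
  let r (k : ZMod n.toNat) (p : Bool) : S := α p ⊓ (e k).1
  have hr : ∀ k p, Rung α γ b p (r k p) := fun k p => h.rung_top_inf (e k).2 p
  have hrf : ∀ k, r k false = (e k).1 := fun k => (e k).2.2.1
  have hmate : ∀ k p q, α p ⊓ r k q = r k p := fun k p q => by
    simp only [r]; rw [← inf_assoc, h.top_inf_top]
  have hft : ∀ k, r k false ⊔ γ true = r (k + 1) true := by
    intro k
    have : (e (k + 1)).1 = α false ⊓ ((e k).1 ⊔ γ true) := congrArg Subtype.val (he k)
    simp only [hrf]
    simp only [r]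
    rw [this, h.top_inf_top_inf (h.rung_sup_bot (e k).2 true)]
  have htf : ∀ k, r k true ⊔ γ false = r (k - 1) false := by
    intro k
    rw [hrf, h.step_symm_apply he]
  have hαinj : ∀ {p q}, α p = α q → p = q := by
    rintro (_ | _) (_ | _) hpq
    exacts [rfl, absurd hpq.symm hα, absurd hpq hα, rfl]
  have hγinj : ∀ {p q}, γ p = γ q → p = q := by
    rintro (_ | _) (_ | _) hpq
    exacts [rfl, absurd hpq.symm hγ, absurd hpq hγ, rfl]
  have hαr : ∀ {p k q}, α p ≠ r k q := by
    intro p k q hpq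
    have h1 := (greenL_iff.1 (hr k q).1).1
    rw [← hpq, h.top_sup (.refl b) p false, h.top_ge.1] at h1
    exact hαb h1
  have hγr : ∀ {p k q}, γ p ≠ r k q := by
    intro p k q hpq
    have h1 := (hr k q).1.2
    rw [← hpq, h.inf_bot (.refl b) p false, (natGE_iff.1 h.ge_bot).1] at h1
    exact hγb h1.symm
  have hαγ : ∀ {p q}, α p ≠ γ q := by
    intro p q hpq
    have h1 := h.top_inf_top false p
    rw [hpq, h.top_inf_bot] at h1
    apply hγb
    rw [← (natGE_iff.1 h.top_ge).1, ← h1, h.bot_inf (.refl b)]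
  let f : X n → S
    | .a p => α p
    | .b k p => r k p
    | .c p => γ p
  refine ⟨f, ?_, ?_, ?_⟩
  · rintro (p | ⟨k, p⟩ | p) (q | ⟨l, q⟩ | q) hpq
    · rw [hαinj hpq]
    · exact absurd hpq hαr
    · exact absurd hpq hαγ
    · exact absurd hpq.symm hαr
    · change r k p = r l q at hpq
      -- A meet with γ false reads off the parity; a meet with α false then recovers the orbit
      -- element.
      have h1 := h.rung_inf_bot (hr k p) false
      rw [hpq, h.rung_inf_bot (hr l q)] at h1
      obtain rfl := hγinj h1
      have h2 := congrArg (α false ⊓ ·) hpq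
      simp only [hmate, hrf] at h2
      rw [hinj (Subtype.ext h2)]
    · exact absurd hpq.symm hγr
    · exact absurd hpq.symm hαγ
    · exact absurd hpq hγr
    · rw [hγinj hpq]
  · rintro (p | ⟨k, p⟩ | p) (q | ⟨l, q⟩ | q)
    · exact (inf_eq_left_iff.1 (h.top_inf_top p q)).symm
    · exact (h.rung_top_sup (hr l q) p).symm
    · exact (h.top_sup_bot p q).symm
    · exact (h.sup_top (hr k p).1 q).symm
    · exact (greenL_iff.1 ((hr k p).1.trans (hr l q).1.symm)).1.symm
    · cases p <;> cases q
      · exact (hr k false).2.2.symm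
      · exact (hft k).symm
      · exact (htf k).symm
      · exact (hr k true).2.2.symm
    · exact (inf_eq_left_iff.1 (h.bot_inf_top p q)).symm
    · exact (h.bot_sup (hr l q).1 p).symm
    · exact (h.bot_sup_bot p q).symm
  · rintro (p | ⟨k, p⟩ | p) (q | ⟨l, q⟩ | q)
    · exact (h.top_inf_top p q).symm
    · exact (hmate l p q).symm
    · exact (h.top_inf_bot p q).symm
    · exact (h.inf_top (hr k p).1 q).symm
    · exact ((hr k p).1.trans (hr l q).1.symm).1.symm
    · exact (h.rung_inf_bot (hr k p) q).symm
    · exact (h.bot_inf_top p q).symm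
    · exact (h.bot_inf (hr l q).1 p).symm
    · exact (h.bot_inf_bot p q).symm

end Ladder

theorem exists_embeds_of_not_isLeftConfluent (hS : ¬ IsLeftConfluent S) :
    ∃ n : ℕ∞, 2 ≤ n ∧ Embeds (X n) S := by
  simp only [IsLeftConfluent, not_forall] at hS
  obtain ⟨a, b, c, a', c', hab, hbc, h1, h2, h3, h4, h5, h6, hne⟩ := hS
  have hac := hab.trans hbc
  have hac' := natGE_iff.1 hac
  have hab' := natGE_iff.1 hab
  let α : Bool → S := fun p => cond p a' a
  let γ : Bool → S := fun p => cond p c' c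
  have h : Ladder α γ b := by
    refine ⟨?_, ?_, ?_, ?_, ?_, hab, hbc⟩
    · rintro (_ | _) (_ | _)
      exacts [inf_idem a, h1, h2, inf_idem a']
    · rintro (_ | _) (_ | _)
      exacts [inf_idem c, h3, h4, inf_idem c']
    · rintro (_ | _) (_ | _)
      · exact hac'.1
      · change a ⊓ c' = c
        rw [← h6, ← inf_assoc, h1, hac'.1]
      · exact h6
      · change a' ⊓ c' = c'
        rw [← h6, ← inf_assoc, inf_idem]
    · have hc : c ⊓ a' = c := by rw [← hac'.2, inf_assoc, h1]
      rintro (_ | _) (_ | _)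
      · exact hac'.2
      · exact hc
      · change c' ⊓ a = c'
        rw [← h6, inf_assoc, hac'.2]
      · change c' ⊓ a' = c'
        rw [← h6, inf_assoc, hc]
    · rintro (_ | _) (_ | _)
      · exact hac.1
      · exact h5
      · change a' ⊔ c = a
        rw [← h5, sup_assoc, inf_eq_left_iff.1 h4, hac.1]
      · change a' ⊔ c' = a'
        rw [← h5, sup_assoc, sup_idem]
  obtain ⟨n, hn, e, hinj, he⟩ := h.exists_enumeration hne
  -- Each degeneracy would make a' ∧ b and b ∨ c' agree: both become b, a' or c'.
  have hγ : c' ≠ c := by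
    rintro rfl
    rw [hac.1] at h5
    subst h5
    exact hne (by rw [hab'.1, hbc.1])
  have hα : a' ≠ a := by
    rintro rfl
    exact hγ (by rw [← h6, hac'.1])
  refine ⟨n, hn, h.embeds_of_enumeration hα hγ ?_ ?_ hinj he⟩
  · intro hab
    exact hne (by rw [← show a = b from hab, h2, h5])
  · intro hbc
    exact hne (by rw [show b = c from hbc, h6, inf_eq_left_iff.1 h3])

end Ladder

end SkewLattice
namespace SkewLattice

/-! ### Assembly of the forbidden-subalgebra criterion. -/

theorem isCategorical_iff {S : Type u} [SkewLattice S] :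
    IsCategorical S ↔ ∀ n : ℕ∞, 2 ≤ n → ¬ Embeds (X n) S ∧ ¬ Embeds (Y n) S := by
  refine ⟨fun hS n hn => ⟨fun h => X.not_isConfluent_of_embeds hn h hS.isConfluent,
    fun h => X.not_isConfluent_of_embeds hn h.of_lrDual_left hS.lrDual.isConfluent⟩,
    fun hS => (IsLeftConfluent.isConfluent ?_ ?_).isCategorical⟩
  · by_contra h
    obtain ⟨n, hn, hX⟩ := exists_embeds_of_not_isLeftConfluent h
    exact (hS n hn).1 hX
  · by_contra h
    obtain ⟨n, hn, hX⟩ := exists_embeds_of_not_isLeftConfluent h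
    exact (hS n hn).2 hX.lrDual_left

theorem not_embeds_Y_of_isLeftHanded {S : Type u} [SkewLattice S] (hS : IsLeftHanded S) (n : ℕ∞) :
    ¬ Embeds (Y n) S :=
  fun h => X.not_embeds_of_isRightHanded hS.lrDual h.of_lrDual_left

end SkewLattice

theorem theorem3p3 :
    (∀ (S : Type u) [SkewLattice S], SkewLattice.IsLeftHanded S →
      (SkewLattice.IsCategorical S ↔
        ∀ n : ℕ∞, 2 ≤ n → ¬ SkewLattice.Embeds (SkewLattice.X n) S)) ∧
    (∀ (S : Type u) [SkewLattice S], SkewLattice.IsRightHanded S →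
      (SkewLattice.IsCategorical S ↔
        ∀ n : ℕ∞, 2 ≤ n → ¬ SkewLattice.Embeds (SkewLattice.Y n) S)) ∧
    (∀ (S : Type u) [SkewLattice S],
      (SkewLattice.IsCategorical S ↔
        ∀ n : ℕ∞, 2 ≤ n → ¬ SkewLattice.Embeds (SkewLattice.X n) S ∧
          ¬ SkewLattice.Embeds (SkewLattice.Y n) S)) ∧
    (∀ m n : ℕ∞, 2 ≤ m → 2 ≤ n →
      (m ≠ n → ¬ SkewLattice.Embeds (SkewLattice.X m) (SkewLattice.X n)) ∧
      (m ≠ n → ¬ SkewLattice.Embeds (SkewLattice.Y m) (SkewLattice.Y n)) ∧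
      ¬ SkewLattice.Embeds (SkewLattice.X m) (SkewLattice.Y n) ∧
      ¬ SkewLattice.Embeds (SkewLattice.Y m) (SkewLattice.X n)) := by

  refine ⟨fun S _ hS => ?_, fun S _ hS => ?_, fun S _ => SkewLattice.isCategorical_iff,
    fun m n hm hn => ⟨fun hmn h => hmn (SkewLattice.X.eq_of_embeds hm hn h),
      fun hmn h => hmn (SkewLattice.X.eq_of_embeds hm hn h.of_lrDual_lrDual),
      SkewLattice.X.not_embeds_of_isRightHanded (SkewLattice.X.isLeftHanded n).lrDual,
      SkewLattice.not_embeds_Y_of_isLeftHanded (SkewLattice.X.isLeftHanded n) m⟩⟩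
  -- In the one-sided cases, handedness already excludes the family of the opposite hand.
  · rw [SkewLattice.isCategorical_iff]
    exact forall₂_congr fun n _ =>
      and_iff_left (SkewLattice.not_embeds_Y_of_isLeftHanded hS n)
  · rw [SkewLattice.isCategorical_iff]
    exact forall₂_congr fun n _ =>
      and_iff_right (SkewLattice.X.not_embeds_of_isRightHanded hS)
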